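/- Conventions. For measurable costs $c_X\colon X\times X\to\mathbb R$, $c_Y\colon Y\times Y\to\mathbb R$ and probability measures $\mu$ on $X$, $\nu$ on $Y$, let $$GW_2^2(c_X,c_Y,\mu,\nu)=\inf_{\pi}\iint |c_X(x,x')-c_Y(y,y')|^2\,d\pi(x,y)\,d\pi(x',y')\in[0,\infty],$$ the infimum being over all couplings $\pi$ of $\mu$ and $\nu$, and let $GW_2$ be its square root; write $GW_2(c,\mu,\nu)$ when $c_X=c_Y=c$. For $\theta$ in the unit sphere $\mathbf S^{q-1}$ of Euclidean $\mathbb R^q$ let $P_\theta(x)=\langle x,\theta\rangle$, and let $d(s,t)=|s-t|$ on $\mathbb R$. For $\mu\in\mathcal P(\mathbb R^p)$, $\nu\in\mathcal P(\mathbb R^q)$ and a matrix $\Delta\in\mathbb R^{q\times p}$, identified with its linear map, put $$SGW_\Delta(\mu,\nu)=\mathbb E_{\theta}\big[GW_2^2(d^2,P_\theta\#\Delta\#\mu,P_\theta\#\nu)\big]\in[0,\infty],$$ with $\theta$ uniform on $\mathbf S^{q-1}$; write $SGW=SGW_{I_p}$ when $p=q$. For $p\le q$ put $RISGW(\mu,\nu)=\inf_{\Delta\in\mathbb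 V_p(\mathbb R^q)}SGW_\Delta(\mu,\nu)$, where $\mathbb V_p(\mathbb R^q)=\{\Delta\in\mathbb R^{q\times p}:\Delta^{T}\Delta=I_p\}$. Theorem. 1. For every $\Delta\in\mathbb R^{q\times p}$, $SGW_\Delta$ is invariant under translations of $\mu$ and of $\nu$; for $p\le q$ so is $RISGW$. If $p=q$ and $Q\in\mathcal O(p)$, then $RISGW(Q\#\mu,\nu)=RISGW(\mu,\nu)=RISGW(\mu,Q\#\nu)$. 2. On $\mathcal P(\mathbb R^p)$ (with $p=q$), $SGW$ and $RISGW$, which are averages of squared distances, are the squares of $[0,\infty]$-valued pseudo-distances. That is, $SGW$ and $RISGW$ are symmetric, $SGW(\mu,\mu)=RISGW(\mu,\mu)=0$, and $\sqrt{SGW}$ and $\sqrt{RISGW}$ satisfy the triangle inequality. 3. Let $\mu,\nu\in\mathcal P(\mathbb R^p)$ have compact supports and $SGW(\mu,\nu)=0$. Then $\mu$ and $\nu$ are isomorphic for the distance $d_{\ell_1}(x,x')=\sum_{i=1}^p|x_i-x'_i|$: there is a surjective map $f\colon\operatorname{supp}\mu\to\operatorname{supp}\nu$ with $f\#\mu=\nu$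 and $d_{\ell_1}(f(x),f(x'))=d_{\ell_1}(x,x')$ for all $x,x'\in\operatorname{supp}\mu$. In particular $GW_2(d_{\ell_1},\mu,\nu)=0$. -/

import Mathlib

open MeasureTheory
open scoped ENNReal

noncomputable section

namespace SlicedGW

/-- `π` is a coupling of `μ` and `ν`: its marginals are `μ` and `ν`. -/
def IsCoupling {X Y : Type*} [MeasurableSpace X] [MeasurableSpace Y]
    (μ : Measure X) (ν : Measure Y) (π : Measure (X × Y)) : Prop :=
  π.map Prod.fst = μ ∧ π.map Prod.snd = ν

/-- The distortion `J(c_X, c_Y, π) = ∬ |c_X(x,x') - c_Y(y,y')|² dπ(x,y) dπ(x',y')`,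
with values in `[0, ∞]`. -/
def distortion {X Y : Type*} [MeasurableSpace X] [MeasurableSpace Y]
    (cX : X → X → ℝ) (cY : Y → Y → ℝ) (π : Measure (X × Y)) : ℝ≥0∞ :=
  ∫⁻ z, ∫⁻ z', ENNReal.ofReal (|cX z.1 z'.1 - cY z.2 z'.2| ^ 2) ∂π ∂π

/-- The square `GW₂²(c_X, c_Y, μ, ν)` of the Gromov-Wasserstein distance of order 2. -/
def GWsq {X Y : Type*} [MeasurableSpace X] [MeasurableSpace Y]
    (cX : X → X → ℝ) (cY : Y → Y → ℝ) (μ : Measure X) (ν : Measure Y) : ℝ≥0∞ :=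
  ⨅ (π : Measure (X × Y)) (_ : IsCoupling μ ν π), distortion cX cY π

/-- The Gromov-Wasserstein distance `GW₂(c_X, c_Y, μ, ν)` of order 2. -/
def GW {X Y : Type*} [MeasurableSpace X] [MeasurableSpace Y]
    (cX : X → X → ℝ) (cY : Y → Y → ℝ) (μ : Measure X) (ν : Measure Y) : ℝ≥0∞ :=
  GWsq cX cY μ ν ^ (1 / 2 : ℝ)

/-- The squared distance on the real line. -/
def sqDist (x y : ℝ) : ℝ := |x - y| ^ 2

/-- The `ℓ¹` distance on `ℝ^p`. -/
def l1Dist {p : ℕ} (x y : EuclideanSpace ℝ (Fin p)) : ℝ := ∑ i, |x i - y i|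

/-- `μ` and `ν` are isomorphic for the costs `cX`, `cY`: a measure-preserving surjection of
`supp μ` onto `supp ν` carries `cX` to `cY`. The values of `f` off `supp μ` play no role. -/
def Isomorphic {X Y : Type*} [TopologicalSpace X] [MeasurableSpace X]
    [TopologicalSpace Y] [MeasurableSpace Y]
    (cX : X → X → ℝ) (cY : Y → Y → ℝ) (μ : Measure X) (ν : Measure Y) : Prop :=
  ∃ f : X → Y, Set.MapsTo f μ.support ν.support ∧ Set.SurjOn f μ.support ν.support ∧
    AEMeasurable f μ ∧ μ.map f = ν ∧
    ∀ x ∈ μ.support, ∀ x' ∈ μ.support, cY (f x) (f x') = cX x x'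

/-- The projection `P_θ(x) = ⟨x, θ⟩`. -/
def proj {q : ℕ} (θ x : EuclideanSpace ℝ (Fin q)) : ℝ := inner ℝ x θ

/-- The sliced Gromov-Wasserstein discrepancy `SGW_Δ(μ, ν)`: the mean over the unit sphere of
`ℝ^q` (normalized surface measure) of `GW₂²(d², P_θ#Δ#μ, P_θ#ν)`. -/
def SGWmap {p q : ℕ} (Δ : Matrix (Fin q) (Fin p) ℝ)
    (μ : Measure (EuclideanSpace ℝ (Fin p))) (ν : Measure (EuclideanSpace ℝ (Fin q))) : ℝ≥0∞ :=
  laverage (volume : Measure (EuclideanSpace ℝ (Fin q))).toSphere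
    fun θ : Metric.sphere (0 : EuclideanSpace ℝ (Fin q)) 1 =>
      GWsq sqDist sqDist ((μ.map (Matrix.toEuclideanLin Δ)).map (proj θ.1)) (ν.map (proj θ.1))

/-- `SGW = SGW_{I_p}`. -/
def SGW {p : ℕ} (μ ν : Measure (EuclideanSpace ℝ (Fin p))) : ℝ≥0∞ :=
  SGWmap (1 : Matrix (Fin p) (Fin p) ℝ) μ ν

/-- The Stiefel manifold `V_p(ℝ^q)`: `q × p` matrices with orthonormal columns. -/
def stiefel (p q : ℕ) : Set (Matrix (Fin q) (Fin p) ℝ) := {Δ | Δ.transpose * Δ = 1}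

/-- The rotation invariant discrepancy: `SGW_Δ` minimized over the Stiefel manifold. -/
def RISGW {p q : ℕ} (μ : Measure (EuclideanSpace ℝ (Fin p)))
    (ν : Measure (EuclideanSpace ℝ (Fin q))) : ℝ≥0∞ :=
  ⨅ Δ ∈ stiefel p q, SGWmap Δ μ ν

end SlicedGW

end

/-!
The sliced discrepancy moves all the geometry onto the direction `θ`: since
`⟨Δx, θ⟩ = ⟨x, Δᵀθ⟩`, `SGW_Δ(μ, ν)` averages the one-dimensional discrepancy between the law of
`⟨·, Δᵀθ⟩` under `μ` and the law of `⟨·, θ⟩` under `ν` (`SGWmap_eq`). Translations act on these laws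
by translations of the line, which preserve the cost. For orthogonal `Δ` the substitution `θ = Δφ`,
which preserves the surface measure (`laverage_sphereRotation`), gives the symmetry
`SGW_Δ(μ, ν) = SGW_{Δᵀ}(ν, μ)`, the orthogonal invariance of `RISGW`, and the triangle inequality
`SGW_{BA}(μ, ρ)^{1/2} ≤ SGW_A(μ, ν)^{1/2} + SGW_B(ν, ρ)^{1/2}` (`SGWmap_triangle`). The last follows
from the triangle inequality for `GW₂` on the line, by gluing of couplings (`GW_triangle`), and from
Minkowski's inequality on the sphere. Minkowski's inequality needs the integrand to be measurable in
`θ`. It is even lower semicontinuous: by Prokhorov's theorem the map that sends a plane measure to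
its two marginals is proper (`isProperMap_marginals`), so sublevel sets of `GW₂²` are images of
closed sets under a proper map, and optimal couplings exist.

If `SGW(μ, ν) = 0`, then in almost every direction an optimal coupling has distortion zero. Its
support lies on a line of slope `±1`, so the projection of `ν` is the image of that of `μ` under
some `t ↦ ±t + c` (`exists_map_of_GWsq_eq_zero`), with a sign that may depend on `θ`. After centring
both measures, `c = 0`, and the characteristic functions satisfy
`(φ_ν(ξ) - φ_μ(ξ)) (φ_ν(ξ) - φ_μ(-ξ)) = 0` for all `ξ`, by density and continuity. Compactness of
the supports makes `φ_μ` and `φ_ν` real-analytic along lines, so one of the two factors vanishes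
identically (`eq_or_eq_map_neg_of_charFun`). Hence `ν` is the image of `μ` under a translation or a
point reflection, and both preserve the `ℓ¹` distance.
-/

namespace SlicedGW

open ProbabilityTheory Filter Topology
open scoped Pointwise

/-! ### Couplings and the Gromov-Wasserstein functional -/

section Coupling

variable {X Y Z : Type*} [MeasurableSpace X] [MeasurableSpace Y] [MeasurableSpace Z]

lemma IsCoupling.isProbabilityMeasure {μ : Measure X} {ν : Measure Y} {π : Measure (X × Y)}
    [IsProbabilityMeasure μ] (h : IsCoupling μ ν π) : IsProbabilityMeasure π := by
  constructor
  rw [← Set.preimage_univ (f := Prod.fst), ← Measure.map_apply measurable_fst .univ, h.1,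
    measure_univ]

lemma IsCoupling.swap {μ : Measure X} {ν : Measure Y} {π : Measure (X × Y)}
    (h : IsCoupling μ ν π) : IsCoupling ν μ (π.map Prod.swap) := by
  refine ⟨?_, ?_⟩
  · rw [Measure.map_map measurable_fst measurable_swap]; exact h.2
  · rw [Measure.map_map measurable_snd measurable_swap]; exact h.1

/-- The gluing lemma: couplings of `(μ, ν)` and of `(ν, ρ)` are the marginals of one measure on
the triple product. It is obtained by disintegrating the second coupling along `ν`. -/
lemma exists_gluing [StandardBorelSpace Z] [Nonempty Z] {μ : Measure X} {ν : Measure Y}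
    {ρ : Measure Z} [IsProbabilityMeasure μ] [IsProbabilityMeasure ν]
    {π₁ : Measure (X × Y)} {π₂ : Measure (Y × Z)}
    (h₁ : IsCoupling μ ν π₁) (h₂ : IsCoupling ν ρ π₂) :
    ∃ m : Measure ((X × Y) × Z), IsProbabilityMeasure m ∧ m.map Prod.fst = π₁ ∧
      m.map (fun z => (z.1.2, z.2)) = π₂ := by
  have := h₁.isProbabilityMeasure
  have := h₂.isProbabilityMeasure
  refine ⟨π₁ ⊗ₘ Kernel.prodMkLeft X π₂.condKernel, inferInstance, Measure.fst_compProd _ _, ?_⟩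
  conv_rhs => rw [← π₂.disintegrate π₂.condKernel]
  have hfst : π₂.fst = π₁.map Prod.snd := h₂.1.trans h₁.2.symm
  rw [hfst]
  refine Measure.ext_of_lintegral _ fun f hf => ?_
  rw [lintegral_map hf (by fun_prop), Measure.lintegral_compProd (by fun_prop),
    Measure.lintegral_compProd hf, lintegral_map hf.lintegral_kernel_prod_right' measurable_snd]
  rfl

lemma measurable_distortion_integrand {cX : X → X → ℝ} {cY : Y → Y → ℝ}
    (hX : Measurable (Function.uncurry cX)) (hY : Measurable (Function.uncurry cY)) :
    Measurable fun w : (X × Y) × X × Y =>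
      ENNReal.ofReal (|cX w.1.1 w.2.1 - cY w.1.2 w.2.2| ^ 2) := by
  have h₁ : Measurable fun w : (X × Y) × X × Y => cX w.1.1 w.2.1 :=
    hX.comp (g := Function.uncurry cX) (f := fun w : (X × Y) × X × Y => (w.1.1, w.2.1))
      (by fun_prop)
  have h₂ : Measurable fun w : (X × Y) × X × Y => cY w.1.2 w.2.2 :=
    hY.comp (g := Function.uncurry cY) (f := fun w : (X × Y) × X × Y => (w.1.2, w.2.2))
      (by fun_prop)
  exact ENNReal.measurable_ofReal.comp ((measurable_norm.comp (h₁.sub h₂)).pow_const 2)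

lemma distortion_eq_lintegral_prod {cX : X → X → ℝ} {cY : Y → Y → ℝ}
    (hX : Measurable (Function.uncurry cX)) (hY : Measurable (Function.uncurry cY))
    (π : Measure (X × Y)) [SFinite π] :
    distortion cX cY π
      = ∫⁻ w, ENNReal.ofReal (|cX w.1.1 w.2.1 - cY w.1.2 w.2.2| ^ 2) ∂(π.prod π) :=
  (lintegral_prod _ (measurable_distortion_integrand hX hY).aemeasurable).symm

lemma distortion_map {cX : X → X → ℝ} {cY : Y → Y → ℝ}
    (hX : Measurable (Function.uncurry cX)) (hY : Measurable (Function.uncurry cY))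
    {m : Measure Z} [SFinite m] {f : Z → X × Y} (hf : Measurable f) :
    distortion cX cY (m.map f)
      = ∫⁻ w, ENNReal.ofReal (|cX (f w.1).1 (f w.2).1 - cY (f w.1).2 (f w.2).2| ^ 2)
          ∂(m.prod m) := by
  rw [distortion_eq_lintegral_prod hX hY, Measure.map_prod_map _ _ hf hf,
    lintegral_map (measurable_distortion_integrand hX hY) (by fun_prop)]
  rfl

lemma GWsq_le {cX : X → X → ℝ} {cY : Y → Y → ℝ} {μ : Measure X} {ν : Measure Y}
    {π : Measure (X × Y)} (h : IsCoupling μ ν π) : GWsq cX cY μ ν ≤ distortion cX cY π :=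
  iInf₂_le π h

lemma GWsq_le_swap {cX : X → X → ℝ} {cY : Y → Y → ℝ}
    (hX : Measurable (Function.uncurry cX)) (hY : Measurable (Function.uncurry cY))
    (μ : Measure X) (ν : Measure Y) [IsProbabilityMeasure μ] :
    GWsq cY cX ν μ ≤ GWsq cX cY μ ν := by
  refine le_iInf₂ fun π hπ => (GWsq_le hπ.swap).trans_eq ?_
  have := hπ.isProbabilityMeasure
  rw [distortion_map hY hX measurable_swap, distortion_eq_lintegral_prod hX hY]
  simp only [Prod.fst_swap, Prod.snd_swap, abs_sub_comm]

lemma GWsq_comm {cX : X → X → ℝ} {cY : Y → Y → ℝ}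
    (hX : Measurable (Function.uncurry cX)) (hY : Measurable (Function.uncurry cY))
    (μ : Measure X) (ν : Measure Y) [IsProbabilityMeasure μ] [IsProbabilityMeasure ν] :
    GWsq cX cY μ ν = GWsq cY cX ν μ :=
  le_antisymm (GWsq_le_swap hY hX ν μ) (GWsq_le_swap hX hY μ ν)

lemma GW_eq_iInf (cX : X → X → ℝ) (cY : Y → Y → ℝ) (μ : Measure X) (ν : Measure Y) :
    GW cX cY μ ν
      = ⨅ (π : Measure (X × Y)) (_ : IsCoupling μ ν π), distortion cX cY π ^ (1 / 2 : ℝ) := by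
  have h : ∀ x : ℝ≥0∞, x ^ (1 / 2 : ℝ) = ENNReal.orderIsoRpow (1 / 2) (by norm_num) x :=
    fun _ => rfl
  simp only [GW, GWsq, h, OrderIso.map_iInf]

/-- A measurable map that carries one cost to the other has a graph coupling of distortion
zero. -/
lemma GWsq_map_eq_zero {cX : X → X → ℝ} {cY : Y → Y → ℝ} (μ : Measure X) {f : X → Y}
    (hf : Measurable f) (hc : ∀ x x', cY (f x) (f x') = cX x x')
    (hX : Measurable (Function.uncurry cX)) (hY : Measurable (Function.uncurry cY))
    [SFinite μ] : GWsq cX cY μ (μ.map f) = 0 := by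
  have hcoup : IsCoupling μ (μ.map f) (μ.map fun x => (x, f x)) := by
    refine ⟨?_, ?_⟩
    · rw [Measure.map_map measurable_fst (by fun_prop)]; exact Measure.map_id
    · rw [Measure.map_map measurable_snd (by fun_prop)]; rfl
  refine le_antisymm ((GWsq_le hcoup).trans_eq ?_) bot_le
  rw [distortion_map hX hY (by fun_prop)]
  simp [hc]

/-- Cost-preserving bijections of the two spaces do not change the Gromov-Wasserstein functional:
they act on couplings and keep their distortion. -/
lemma GWsq_map_map {cX : X → X → ℝ} {cY : Y → Y → ℝ}
    (hX : Measurable (Function.uncurry cX)) (hY : Measurable (Function.uncurry cY))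
    (μ : Measure X) (ν : Measure Y) [IsProbabilityMeasure μ] (e : X ≃ᵐ X) (g : Y ≃ᵐ Y)
    (he : ∀ x x', cX (e x) (e x') = cX x x') (hg : ∀ y y', cY (g y) (g y') = cY y y') :
    GWsq cX cY (μ.map e) (ν.map g) = GWsq cX cY μ ν := by
  have key : ∀ (μ : Measure X) (ν : Measure Y) [IsProbabilityMeasure μ] (e : X ≃ᵐ X)
      (g : Y ≃ᵐ Y), (∀ x x', cX (e x) (e x') = cX x x') →
      (∀ y y', cY (g y) (g y') = cY y y') →
      GWsq cX cY (μ.map e) (ν.map g) ≤ GWsq cX cY μ ν := by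
    intro μ ν _ e g he hg
    refine le_iInf₂ fun π hπ => ?_
    have := hπ.isProbabilityMeasure
    have hcoup : IsCoupling (μ.map e) (ν.map g) (π.map (Prod.map e g)) := by
      have hm : Measurable (Prod.map e g) := e.measurable.prodMap g.measurable
      refine ⟨?_, ?_⟩
      · rw [Measure.map_map measurable_fst hm, ← hπ.1,
          Measure.map_map e.measurable measurable_fst]; rfl
      · rw [Measure.map_map measurable_snd hm, ← hπ.2,
          Measure.map_map g.measurable measurable_snd]; rfl
    refine (GWsq_le hcoup).trans_eq ?_
    rw [distortion_map hX hY (e.measurable.prodMap g.measurable),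
      distortion_eq_lintegral_prod hX hY]
    simp [he, hg]
  refine le_antisymm (key μ ν e g he hg) ?_
  have := Measure.isProbabilityMeasure_map (μ := μ) e.measurable.aemeasurable
  have h := key (μ.map e) (ν.map g) e.symm g.symm
    (fun x x' => by rw [← he]; simp) (fun y y' => by rw [← hg]; simp)
  simpa using h

lemma ofReal_abs_sq_rpow (u : ℝ) :
    ENNReal.ofReal (|u| ^ 2) = ENNReal.ofReal |u| ^ (2 : ℝ) := by
  rw [ENNReal.ofReal_pow (abs_nonneg u)]; norm_cast

/-- The triangle inequality for `GW₂`: glue two couplings, then apply Minkowski's inequality in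
`L²` of the square of the glued measure. -/
lemma GW_triangle [StandardBorelSpace Z] [Nonempty Z] {cX : X → X → ℝ} {cY : Y → Y → ℝ}
    {cZ : Z → Z → ℝ} (hX : Measurable (Function.uncurry cX))
    (hY : Measurable (Function.uncurry cY)) (hZ : Measurable (Function.uncurry cZ))
    (μ : Measure X) (ν : Measure Y) (ρ : Measure Z) [IsProbabilityMeasure μ]
    [IsProbabilityMeasure ν] :
    GW cX cZ μ ρ ≤ GW cX cY μ ν + GW cY cZ ν ρ := by
  have key : ∀ π₁ : Measure (X × Y), IsCoupling μ ν π₁ → ∀ π₂ : Measure (Y × Z),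
      IsCoupling ν ρ π₂ → GW cX cZ μ ρ
        ≤ distortion cX cY π₁ ^ (1 / 2 : ℝ) + distortion cY cZ π₂ ^ (1 / 2 : ℝ) := by
    intro π₁ h₁ π₂ h₂
    obtain ⟨m, hm, rfl, rfl⟩ := exists_gluing h₁ h₂
    have hcoup : IsCoupling μ ρ (m.map fun z => (z.1.1, z.2)) := by
      refine ⟨?_, ?_⟩
      · rw [← h₁.1, Measure.map_map measurable_fst (by fun_prop),
          Measure.map_map measurable_fst (by fun_prop)]; rfl
      · rw [← h₂.2, Measure.map_map measurable_snd (by fun_prop),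
          Measure.map_map measurable_snd (by fun_prop)]; rfl
    refine (ENNReal.rpow_le_rpow (GWsq_le hcoup) (by norm_num)).trans ?_
    rw [distortion_map hX hZ (by fun_prop), distortion_map hX hY (by fun_prop),
      distortion_map hY hZ (by fun_prop)]
    simp only [ofReal_abs_sq_rpow]
    have hX' : Measurable fun w : ((X × Y) × Z) × ((X × Y) × Z) => cX w.1.1.1 w.2.1.1 :=
      hX.comp (g := Function.uncurry cX)
        (f := fun w : ((X × Y) × Z) × ((X × Y) × Z) => (w.1.1.1, w.2.1.1)) (by fun_prop)
    have hY' : Measurable fun w : ((X × Y) × Z) × ((X × Y) × Z) => cY w.1.1.2 w.2.1.2 :=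
      hY.comp (g := Function.uncurry cY)
        (f := fun w : ((X × Y) × Z) × ((X × Y) × Z) => (w.1.1.2, w.2.1.2)) (by fun_prop)
    have hZ' : Measurable fun w : ((X × Y) × Z) × ((X × Y) × Z) => cZ w.1.2 w.2.2 :=
      hZ.comp (g := Function.uncurry cZ)
        (f := fun w : ((X × Y) × Z) × ((X × Y) × Z) => (w.1.2, w.2.2)) (by fun_prop)
    refine le_trans ?_ (ENNReal.lintegral_Lp_add_le (p := 2)
      (ENNReal.measurable_ofReal.comp (measurable_norm.comp (hX'.sub hY'))).aemeasurable
      (ENNReal.measurable_ofReal.comp (measurable_norm.comp (hY'.sub hZ'))).aemeasurable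
      (by norm_num))
    gcongr with w
    simp only [Pi.add_apply]
    rw [← ENNReal.ofReal_add (abs_nonneg _) (abs_nonneg _)]
    exact ENNReal.ofReal_le_ofReal (abs_sub_le _ _ _)
  rw [GW_eq_iInf cX cY, GW_eq_iInf cY cZ]
  simp only [ENNReal.iInf_add, ENNReal.add_iInf]
  exact le_iInf₂ fun π₂ h₂ => le_iInf₂ fun π₁ h₁ => key π₁ h₁ π₂ h₂

end Coupling

lemma measurable_sqDist : Measurable (Function.uncurry sqDist) := by
  unfold sqDist Function.uncurry
  exact (measurable_norm.comp (measurable_fst.sub measurable_snd)).pow_const 2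

/-! ### Lower semicontinuity -/

lemma lowerSemicontinuous_lintegral {X : Type*} [MeasurableSpace X] [TopologicalSpace X]
    [OpensMeasurableSpace X] {f : X → ℝ≥0∞} (hf : Continuous f) :
    LowerSemicontinuous fun P : ProbabilityMeasure X => ∫⁻ x, f x ∂(P : Measure X) := by
  have hn : ∀ n : ℕ, Continuous fun x => (min (f x) n).toNNReal := fun n =>
    ENNReal.continuousOn_toNNReal.comp_continuous (hf.min continuous_const) fun x =>
      ne_top_of_le_ne_top (ENNReal.natCast_ne_top n) (min_le_right _ _)
  have hb : ∀ (n : ℕ) (x y : X),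
      dist (min (f x) n).toNNReal (min (f y) n).toNNReal ≤ n := by
    have : ∀ (n : ℕ) (x : X), ((min (f x) n).toNNReal : ℝ) ≤ n := fun n x => by
      have := ENNReal.toNNReal_mono (ENNReal.natCast_ne_top n) (min_le_right (f x) n)
      exact_mod_cast this
    intro n x y
    rw [NNReal.dist_eq, abs_le]
    have h1 := this n x
    have h2 := this n y
    have h3 := NNReal.coe_nonneg (min (f x) n).toNNReal
    have h4 := NNReal.coe_nonneg (min (f y) n).toNNReal
    constructor <;> linarith
  let F : ℕ → BoundedContinuousFunction X NNReal := fun n => ⟨⟨_, hn n⟩, n, hb n⟩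
  have hF : ∀ n x, (F n x : ℝ≥0∞) = min (f x) n := fun n x =>
    ENNReal.coe_toNNReal (ne_top_of_le_ne_top (ENNReal.natCast_ne_top n) (min_le_right _ _))
  have hsup : (fun P : ProbabilityMeasure X => ∫⁻ x, f x ∂(P : Measure X))
      = fun P : ProbabilityMeasure X => ⨆ n, ∫⁻ x, F n x ∂(P : Measure X) := by
    funext P
    rw [← lintegral_iSup]
    · congr 1
      funext x
      simp only [hF]
      refine le_antisymm ?_ (iSup_le fun n => min_le_left _ _)
      rw [← inf_iSup_eq, ENNReal.iSup_natCast, inf_top_eq]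
    · exact fun n => ((F n).continuous.measurable).coe_nnreal_ennreal
    · intro n k hnk x
      simp only [hF]
      gcongr
  rw [hsup]
  refine lowerSemicontinuous_iSup fun n => Continuous.lowerSemicontinuous ?_
  exact continuous_iff_continuousAt.2 fun P =>
    ProbabilityMeasure.tendsto_iff_forall_lintegral_tendsto.1 tendsto_id (F n)

lemma lowerSemicontinuous_distortion :
    LowerSemicontinuous fun P : ProbabilityMeasure (ℝ × ℝ) =>
      distortion sqDist sqDist (P : Measure (ℝ × ℝ)) := by
  have hc : Continuous fun w : (ℝ × ℝ) × ℝ × ℝ =>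
      ENNReal.ofReal (|sqDist w.1.1 w.2.1 - sqDist w.1.2 w.2.2| ^ 2) := by
    unfold sqDist; exact ENNReal.continuous_ofReal.comp (by fun_prop)
  have h := (lowerSemicontinuous_lintegral hc).comp
    (ProbabilityMeasure.continuous_prod.comp
      (continuous_id.prodMk (continuous_id (X := ProbabilityMeasure (ℝ × ℝ)))))
  convert h using 2 with P
  exact distortion_eq_lintegral_prod measurable_sqDist measurable_sqDist _

/-- The pair of marginals of a probability measure on the plane. -/
noncomputable def marginals (P : ProbabilityMeasure (ℝ × ℝ)) :
    ProbabilityMeasure ℝ × ProbabilityMeasure ℝ :=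
  (P.map measurable_fst.aemeasurable, P.map measurable_snd.aemeasurable)

lemma continuous_marginals : Continuous marginals :=
  (ProbabilityMeasure.continuous_map continuous_fst).prodMk
    (ProbabilityMeasure.continuous_map continuous_snd)

/-- Prokhorov's theorem in the form needed for couplings: measures whose marginals stay in a
compact set form a compact set, because tightness of the marginals gives tightness of the
couplings. -/
lemma isProperMap_marginals : IsProperMap marginals := by
  refine isProperMap_iff_isCompact_preimage.2 ⟨continuous_marginals, fun K hK => ?_⟩
  have htight : ∀ S : Set (ProbabilityMeasure ℝ), IsCompact S →
      IsTightMeasureSet {((μ : ProbabilityMeasure ℝ) : Measure ℝ) | μ ∈ S} := fun S hS =>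
    isTightMeasureSet_of_isCompact_closure (hS.isClosed.closure_eq.symm ▸ hS)
  have h : IsCompact (closure (marginals ⁻¹' K)) := by
    refine isCompact_closure_of_isTightMeasureSet (IsTightMeasureSet.prodMk ?_ ?_)
    · refine (htight _ (hK.image continuous_fst)).subset ?_
      rintro _ ⟨_, ⟨P, hP, rfl⟩, rfl⟩
      exact ⟨(marginals P).1, ⟨_, hP, rfl⟩, rfl⟩
    · refine (htight _ (hK.image continuous_snd)).subset ?_
      rintro _ ⟨_, ⟨P, hP, rfl⟩, rfl⟩
      exact ⟨(marginals P).2, ⟨_, hP, rfl⟩, rfl⟩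
  rwa [(hK.isClosed.preimage continuous_marginals).closure_eq] at h

lemma marginals_eq_iff {P : ProbabilityMeasure (ℝ × ℝ)}
    {a : ProbabilityMeasure ℝ × ProbabilityMeasure ℝ} :
    marginals P = a ↔ IsCoupling (a.1 : Measure ℝ) (a.2 : Measure ℝ) (P : Measure (ℝ × ℝ)) := by
  rw [Prod.ext_iff, IsCoupling]
  exact and_congr Subtype.ext_iff Subtype.ext_iff

/-- Optimal couplings exist. -/
lemma exists_isCoupling_distortion_eq (α β : Measure ℝ) [IsProbabilityMeasure α]
    [IsProbabilityMeasure β] :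
    ∃ π, IsCoupling α β π ∧ distortion sqDist sqDist π = GWsq sqDist sqDist α β := by
  let a : ProbabilityMeasure ℝ × ProbabilityMeasure ℝ := (⟨α, ‹_›⟩, ⟨β, ‹_›⟩)
  have hne : (marginals ⁻¹' {a}).Nonempty :=
    ⟨⟨α.prod β, inferInstance⟩, marginals_eq_iff.2 ⟨by simp [a], by simp [a]⟩⟩
  obtain ⟨P, hP, hmin⟩ := lowerSemicontinuous_distortion.lowerSemicontinuousOn
    (marginals ⁻¹' {a}) |>.exists_isMinOn hne (isProperMap_marginals.isCompact_preimage
      isCompact_singleton)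
  have hP' := marginals_eq_iff.1 hP
  refine ⟨P, hP', le_antisymm (le_iInf₂ fun π hπ => ?_) (GWsq_le hP')⟩
  have := hπ.isProbabilityMeasure
  exact hmin (a := ⟨π, this⟩) (marginals_eq_iff.2 hπ)

lemma lowerSemicontinuous_GWsq :
    LowerSemicontinuous fun a : ProbabilityMeasure ℝ × ProbabilityMeasure ℝ =>
      GWsq sqDist sqDist (a.1 : Measure ℝ) (a.2 : Measure ℝ) := by
  refine lowerSemicontinuous_iff_isClosed_preimage.2 fun c => ?_
  convert isProperMap_marginals.isClosedMap _
    (lowerSemicontinuous_iff_isClosed_preimage.1 lowerSemicontinuous_distortion c) using 1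
  ext a
  constructor
  · intro ha
    obtain ⟨π, hπ, h⟩ := exists_isCoupling_distortion_eq (a.1 : Measure ℝ) (a.2 : Measure ℝ)
    have := hπ.isProbabilityMeasure
    exact ⟨⟨π, this⟩, h.trans_le ha, marginals_eq_iff.2 hπ⟩
  · rintro ⟨P, hP, h⟩
    exact (GWsq_le (marginals_eq_iff.1 h)).trans hP

section Projection

variable {p q : ℕ}

lemma continuous_proj (θ : EuclideanSpace ℝ (Fin q)) : Continuous (proj θ) := by
  unfold proj; fun_prop

lemma isProbabilityMeasure_map_proj (μ : Measure (EuclideanSpace ℝ (Fin q)))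
    [IsProbabilityMeasure μ] (θ : EuclideanSpace ℝ (Fin q)) :
    IsProbabilityMeasure (μ.map (proj θ)) :=
  Measure.isProbabilityMeasure_map (continuous_proj θ).aemeasurable

/-- The law of `P_θ` under `μ`, as a point of the space of probability measures on the line. -/
noncomputable def projLaw (μ : Measure (EuclideanSpace ℝ (Fin q))) [IsProbabilityMeasure μ]
    (θ : EuclideanSpace ℝ (Fin q)) : ProbabilityMeasure ℝ :=
  ⟨μ.map (proj θ), isProbabilityMeasure_map_proj μ θ⟩

lemma continuous_projLaw (μ : Measure (EuclideanSpace ℝ (Fin q))) [IsProbabilityMeasure μ] :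
    Continuous (projLaw μ) := by
  refine continuous_iff_continuousAt.2 fun θ =>
    ProbabilityMeasure.tendsto_iff_forall_integral_tendsto.2 fun f => ?_
  have h : ∀ θ, ∫ t, f t ∂(μ.map (proj θ)) = ∫ x, f (proj θ x) ∂μ := fun θ =>
    integral_map (continuous_proj θ).aemeasurable f.continuous.aestronglyMeasurable
  simp only [projLaw, ProbabilityMeasure.coe_mk, h]
  refine (continuous_of_dominated (bound := fun _ => ‖f‖) (fun θ => ?_) (fun θ => ?_)
    (integrable_const _) (.of_forall fun x => ?_)).tendsto θ
  · exact (f.continuous.comp (continuous_proj θ)).aestronglyMeasurable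
  · exact .of_forall fun x => f.norm_coe_le_norm _
  · unfold proj; fun_prop

/-- The integrand of the sliced discrepancy is measurable in the direction. -/
lemma measurable_GWsq_map_proj (μ : Measure (EuclideanSpace ℝ (Fin p)))
    (ν : Measure (EuclideanSpace ℝ (Fin q))) [IsProbabilityMeasure μ] [IsProbabilityMeasure ν]
    {T : Type*} [TopologicalSpace T] [MeasurableSpace T] [OpensMeasurableSpace T]
    {a : T → EuclideanSpace ℝ (Fin p)} {b : T → EuclideanSpace ℝ (Fin q)}
    (ha : Continuous a) (hb : Continuous b) :
    Measurable fun t => GWsq sqDist sqDist (μ.map (proj (a t))) (ν.map (proj (b t))) :=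
  (lowerSemicontinuous_GWsq.comp
    (((continuous_projLaw μ).comp ha).prodMk ((continuous_projLaw ν).comp hb))).measurable

end Projection

/-! ### Rotations of the sphere -/

section Rotation

variable {E : Type*} [NormedAddCommGroup E] [InnerProductSpace ℝ E]

/-- The homeomorphism of the unit sphere induced by a linear isometry. -/
def sphereRotation (L : E ≃ₗᵢ[ℝ] E) :
    Metric.sphere (0 : E) 1 ≃ₜ Metric.sphere (0 : E) 1 :=
  L.toHomeomorph.subtype fun x => by simp

variable [FiniteDimensional ℝ E] [MeasurableSpace E] [BorelSpace E]

lemma map_sphereRotation_toSphere (L : E ≃ₗᵢ[ℝ] E) :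
    (volume : Measure E).toSphere.map (sphereRotation L) = (volume : Measure E).toSphere := by
  refine Measure.ext fun s hs => ?_
  have hm : Measurable (sphereRotation L) := (sphereRotation L).continuous.measurable
  rw [Measure.map_apply hm hs, Measure.toSphere_apply' _ hs, Measure.toSphere_apply' _ (hm hs)]
  congr 1
  have hset : Set.Ioo (0 : ℝ) 1 • ((↑) '' (sphereRotation L ⁻¹' s) : Set E)
      = L ⁻¹' (Set.Ioo (0 : ℝ) 1 • ((↑) '' s : Set E)) := by
    ext x
    simp only [Set.mem_smul, Set.mem_preimage]
    constructor
    · rintro ⟨r, hr, _, ⟨y, hy, rfl⟩, rfl⟩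
      exact ⟨r, hr, _, ⟨_, hy, rfl⟩, by simp [sphereRotation]⟩
    · rintro ⟨r, hr, _, ⟨y, hy, rfl⟩, hx⟩
      refine ⟨r, hr, _, ⟨(sphereRotation L).symm y, by simpa using hy, rfl⟩, ?_⟩
      apply L.injective
      rw [← hx, map_smul]
      congr 1
      exact congrArg Subtype.val ((sphereRotation L).apply_symm_apply y)
  rw [hset]
  exact L.measurePreserving.measure_preimage_equiv (f := L.toMeasurableEquiv) _

lemma laverage_sphereRotation (L : E ≃ₗᵢ[ℝ] E) (f : Metric.sphere (0 : E) 1 → ℝ≥0∞) :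
    laverage (volume : Measure E).toSphere (fun θ => f (sphereRotation L θ))
      = laverage (volume : Measure E).toSphere f := by
  rw [laverage_eq, laverage_eq]
  congr 1
  conv_rhs => rw [← map_sphereRotation_toSphere L]
  exact (lintegral_map_equiv f (sphereRotation L).toMeasurableEquiv).symm

end Rotation

section Orthogonal

variable {p q : ℕ}

lemma inner_toEuclideanLin (Δ : Matrix (Fin q) (Fin p) ℝ) (x : EuclideanSpace ℝ (Fin p))
    (y : EuclideanSpace ℝ (Fin q)) :
    inner ℝ (Matrix.toEuclideanLin Δ x) y
      = inner ℝ x (Matrix.toEuclideanLin Δ.transpose y) := by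
  have h := Matrix.toEuclideanLin_conjTranspose_eq_adjoint Δ
  rw [Matrix.conjTranspose_eq_transpose_of_trivial] at h
  rw [h, LinearMap.adjoint_inner_right]

lemma toEuclideanLin_mul_apply {r : ℕ} (A : Matrix (Fin r) (Fin q) ℝ)
    (B : Matrix (Fin q) (Fin p) ℝ) (x : EuclideanSpace ℝ (Fin p)) :
    Matrix.toEuclideanLin (A * B) x = Matrix.toEuclideanLin A (Matrix.toEuclideanLin B x) := by
  simp [Matrix.toLpLin_apply, Matrix.mulVec_mulVec]

lemma toEuclideanLin_one_apply (x : EuclideanSpace ℝ (Fin p)) :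
    Matrix.toEuclideanLin (1 : Matrix (Fin p) (Fin p) ℝ) x = x := by
  simp

lemma continuous_toEuclideanLin (Δ : Matrix (Fin q) (Fin p) ℝ) :
    Continuous (Matrix.toEuclideanLin Δ) :=
  LinearMap.continuous_of_finiteDimensional _

/-- A square matrix with orthonormal columns, as a linear isometry. -/
noncomputable def stiefelIsometry {Δ : Matrix (Fin p) (Fin p) ℝ} (h : Δ ∈ stiefel p p) :
    EuclideanSpace ℝ (Fin p) ≃ₗᵢ[ℝ] EuclideanSpace ℝ (Fin p) :=
  LinearIsometry.toLinearIsometryEquiv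
    ((Matrix.toEuclideanLin Δ).isometryOfInner fun x y => by
      rw [inner_toEuclideanLin, ← toEuclideanLin_mul_apply, show Δ.transpose * Δ = 1 from h,
        toEuclideanLin_one_apply]) rfl

lemma sphereRotation_stiefelIsometry {Δ : Matrix (Fin p) (Fin p) ℝ} (h : Δ ∈ stiefel p p)
    (θ : Metric.sphere (0 : EuclideanSpace ℝ (Fin p)) 1) :
    (sphereRotation (stiefelIsometry h) θ : EuclideanSpace ℝ (Fin p))
      = Matrix.toEuclideanLin Δ θ := rfl

lemma one_mem_stiefel : (1 : Matrix (Fin p) (Fin p) ℝ) ∈ stiefel p p := by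
  simp [stiefel]

lemma transpose_mem_stiefel {Δ : Matrix (Fin p) (Fin p) ℝ} (h : Δ ∈ stiefel p p) :
    Δ.transpose ∈ stiefel p p := by
  simpa [stiefel] using mul_eq_one_comm.1 h

lemma mul_mem_stiefel {A B : Matrix (Fin p) (Fin p) ℝ} (hA : A ∈ stiefel p p)
    (hB : B ∈ stiefel p p) : A * B ∈ stiefel p p := by
  simp only [stiefel, Set.mem_ofPred_eq] at *
  rw [Matrix.transpose_mul, Matrix.mul_assoc, ← Matrix.mul_assoc A.transpose, hA, one_mul, hB]

lemma mem_stiefel_of_mem_orthogonalGroup {Q : Matrix (Fin p) (Fin p) ℝ}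
    (h : Q ∈ Matrix.orthogonalGroup (Fin p) ℝ) : Q ∈ stiefel p p :=
  (Matrix.mem_orthogonalGroup_iff' _ _).1 h

/-! ### Invariances and pseudo-distance properties -/

lemma proj_toEuclideanLin (Δ : Matrix (Fin q) (Fin p) ℝ) (θ : EuclideanSpace ℝ (Fin q))
    (x : EuclideanSpace ℝ (Fin p)) :
    proj θ (Matrix.toEuclideanLin Δ x) = proj (Matrix.toEuclideanLin Δ.transpose θ) x :=
  inner_toEuclideanLin Δ x θ

lemma map_map_proj (Δ : Matrix (Fin q) (Fin p) ℝ) (μ : Measure (EuclideanSpace ℝ (Fin p)))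
    (θ : EuclideanSpace ℝ (Fin q)) :
    (μ.map (Matrix.toEuclideanLin Δ)).map (proj θ)
      = μ.map (proj (Matrix.toEuclideanLin Δ.transpose θ)) := by
  rw [Measure.map_map (continuous_proj θ).measurable (continuous_toEuclideanLin Δ).measurable]
  exact congrArg (μ.map ·) (funext (proj_toEuclideanLin Δ θ))

/-- The sliced discrepancy with the matrix moved from the measure to the direction. -/
lemma SGWmap_eq (Δ : Matrix (Fin q) (Fin p) ℝ) (μ : Measure (EuclideanSpace ℝ (Fin p)))
    (ν : Measure (EuclideanSpace ℝ (Fin q))) :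
    SGWmap Δ μ ν = laverage (volume : Measure (EuclideanSpace ℝ (Fin q))).toSphere fun θ =>
      GWsq sqDist sqDist (μ.map (proj (Matrix.toEuclideanLin Δ.transpose θ.1)))
        (ν.map (proj θ.1)) := by
  simp only [SGWmap, map_map_proj]

lemma map_add_map_proj (μ : Measure (EuclideanSpace ℝ (Fin q))) (a θ : EuclideanSpace ℝ (Fin q)) :
    (μ.map fun x => x + a).map (proj θ)
      = (μ.map (proj θ)).map (MeasurableEquiv.addRight (proj θ a)) := by
  rw [Measure.map_map (continuous_proj θ).measurable (by fun_prop),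
    Measure.map_map (MeasurableEquiv.measurable _) (continuous_proj θ).measurable]
  congr 1
  funext x
  simp [proj, inner_add_left]

lemma SGWmap_translate (Δ : Matrix (Fin q) (Fin p) ℝ) (μ : Measure (EuclideanSpace ℝ (Fin p)))
    (ν : Measure (EuclideanSpace ℝ (Fin q))) [IsProbabilityMeasure μ]
    (a : EuclideanSpace ℝ (Fin p)) (b : EuclideanSpace ℝ (Fin q)) :
    SGWmap Δ (μ.map fun x => x + a) (ν.map fun y => y + b) = SGWmap Δ μ ν := by
  rw [SGWmap_eq, SGWmap_eq]
  congr 1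
  funext θ
  rw [map_add_map_proj, map_add_map_proj]
  have := isProbabilityMeasure_map_proj μ (Matrix.toEuclideanLin Δ.transpose θ.1)
  exact GWsq_map_map measurable_sqDist measurable_sqDist _ _ _ _
    (fun x x' => by simp [sqDist]) (fun x x' => by simp [sqDist])

lemma RISGW_translate (μ : Measure (EuclideanSpace ℝ (Fin p)))
    (ν : Measure (EuclideanSpace ℝ (Fin q))) [IsProbabilityMeasure μ]
    (a : EuclideanSpace ℝ (Fin p)) (b : EuclideanSpace ℝ (Fin q)) :
    RISGW (μ.map fun x => x + a) (ν.map fun y => y + b) = RISGW μ ν := by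
  simp only [RISGW, SGWmap_translate]

lemma SGWmap_map_left (Δ Q : Matrix (Fin p) (Fin p) ℝ)
    (μ ν : Measure (EuclideanSpace ℝ (Fin p))) :
    SGWmap Δ (μ.map (Matrix.toEuclideanLin Q)) ν = SGWmap (Δ * Q) μ ν := by
  simp only [SGWmap_eq, map_map_proj, Matrix.transpose_mul, toEuclideanLin_mul_apply]

lemma SGWmap_map_right (Δ : Matrix (Fin p) (Fin p) ℝ) {Q : Matrix (Fin p) (Fin p) ℝ}
    (hQ : Q ∈ stiefel p p) (μ ν : Measure (EuclideanSpace ℝ (Fin p))) :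
    SGWmap Δ μ (ν.map (Matrix.toEuclideanLin Q)) = SGWmap (Q.transpose * Δ) μ ν := by
  rw [SGWmap_eq, SGWmap_eq, ← laverage_sphereRotation (stiefelIsometry hQ)]
  have hQ' : Q.transpose * Q = 1 := hQ
  congr 1
  funext θ
  rw [map_map_proj, sphereRotation_stiefelIsometry, ← toEuclideanLin_mul_apply,
    ← toEuclideanLin_mul_apply, hQ', toEuclideanLin_one_apply, Matrix.transpose_mul,
    Matrix.transpose_transpose]

lemma SGWmap_comm {Δ : Matrix (Fin p) (Fin p) ℝ} (hΔ : Δ ∈ stiefel p p)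
    (μ ν : Measure (EuclideanSpace ℝ (Fin p))) [IsProbabilityMeasure μ] [IsProbabilityMeasure ν] :
    SGWmap Δ μ ν = SGWmap Δ.transpose ν μ := by
  rw [SGWmap_eq, SGWmap_eq, ← laverage_sphereRotation (stiefelIsometry hΔ)]
  have hΔ' : Δ.transpose * Δ = 1 := hΔ
  congr 1
  funext θ
  rw [sphereRotation_stiefelIsometry, ← toEuclideanLin_mul_apply, hΔ', toEuclideanLin_one_apply,
    Matrix.transpose_transpose]
  have := isProbabilityMeasure_map_proj μ θ.1
  have := isProbabilityMeasure_map_proj ν (Matrix.toEuclideanLin Δ θ.1)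
  exact GWsq_comm measurable_sqDist measurable_sqDist _ _

lemma GW_rpow_two {X Y : Type*} [MeasurableSpace X] [MeasurableSpace Y] (cX : X → X → ℝ)
    (cY : Y → Y → ℝ) (μ : Measure X) (ν : Measure Y) :
    GW cX cY μ ν ^ (2 : ℝ) = GWsq cX cY μ ν := by
  rw [GW, ← ENNReal.rpow_mul]; norm_num

/-- The triangle inequality for `SGW_Δ`: the middle term `SGW_A(μ, ν)` is an average over `φ`, and
`φ = Bᵀθ` turns it into an average over `θ`; then the triangle inequality on the line and
Minkowski's inequality on the sphere apply. -/
lemma SGWmap_triangle (A : Matrix (Fin p) (Fin p) ℝ) {B : Matrix (Fin p) (Fin p) ℝ}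
    (hB : B ∈ stiefel p p) (μ ν ρ : Measure (EuclideanSpace ℝ (Fin p)))
    [IsProbabilityMeasure μ] [IsProbabilityMeasure ν] [IsProbabilityMeasure ρ] :
    SGWmap (B * A) μ ρ ^ (1 / 2 : ℝ)
      ≤ SGWmap A μ ν ^ (1 / 2 : ℝ) + SGWmap B ν ρ ^ (1 / 2 : ℝ) := by
  rw [SGWmap_eq, SGWmap_eq, SGWmap_eq,
    ← laverage_sphereRotation (stiefelIsometry (transpose_mem_stiefel hB))
      (fun θ => GWsq sqDist sqDist (μ.map (proj (Matrix.toEuclideanLin A.transpose θ.1)))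
        (ν.map (proj θ.1)))]
  simp only [sphereRotation_stiefelIsometry, Matrix.transpose_mul, toEuclideanLin_mul_apply]
  simp only [← GW_rpow_two, laverage]
  have hcont := fun Δ : Matrix (Fin p) (Fin p) ℝ => continuous_toEuclideanLin Δ
  refine le_trans ?_ (ENNReal.lintegral_Lp_add_le
    ((measurable_GWsq_map_proj μ ν
      ((hcont A.transpose).comp ((hcont B.transpose).comp continuous_subtype_val))
      ((hcont B.transpose).comp continuous_subtype_val)).pow_const (1 / 2 : ℝ)).aemeasurable
    ((measurable_GWsq_map_proj ν ρ
      ((hcont B.transpose).comp continuous_subtype_val)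
      continuous_subtype_val).pow_const (1 / 2 : ℝ)).aemeasurable (by norm_num))
  gcongr with θ
  have := isProbabilityMeasure_map_proj μ
    (Matrix.toEuclideanLin A.transpose (Matrix.toEuclideanLin B.transpose θ.1))
  have := isProbabilityMeasure_map_proj ν (Matrix.toEuclideanLin B.transpose θ.1)
  exact GW_triangle measurable_sqDist measurable_sqDist measurable_sqDist _ _ _

lemma SGW_self (μ : Measure (EuclideanSpace ℝ (Fin p))) [IsProbabilityMeasure μ] :
    SGW μ μ = 0 := by
  rw [SGW, SGWmap_eq]
  have h : ∀ θ : EuclideanSpace ℝ (Fin p),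
      GWsq sqDist sqDist (μ.map (proj θ)) (μ.map (proj θ)) = 0 := fun θ => by
    have := isProbabilityMeasure_map_proj μ θ
    simpa using GWsq_map_eq_zero (μ.map (proj θ)) measurable_id (fun _ _ => rfl)
      measurable_sqDist measurable_sqDist
  simp [h]

lemma SGW_comm (μ ν : Measure (EuclideanSpace ℝ (Fin p))) [IsProbabilityMeasure μ]
    [IsProbabilityMeasure ν] : SGW μ ν = SGW ν μ := by
  simpa [SGW] using SGWmap_comm one_mem_stiefel μ ν

lemma SGW_triangle (μ ν ρ : Measure (EuclideanSpace ℝ (Fin p)))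
    [IsProbabilityMeasure μ] [IsProbabilityMeasure ν] [IsProbabilityMeasure ρ] :
    SGW μ ρ ^ (1 / 2 : ℝ) ≤ SGW μ ν ^ (1 / 2 : ℝ) + SGW ν ρ ^ (1 / 2 : ℝ) := by
  simpa [SGW] using SGWmap_triangle 1 one_mem_stiefel μ ν ρ

lemma RISGW_le {Δ : Matrix (Fin q) (Fin p) ℝ} (h : Δ ∈ stiefel p q)
    (μ : Measure (EuclideanSpace ℝ (Fin p))) (ν : Measure (EuclideanSpace ℝ (Fin q))) :
    RISGW μ ν ≤ SGWmap Δ μ ν :=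
  iInf₂_le Δ h

lemma RISGW_self (μ : Measure (EuclideanSpace ℝ (Fin p))) [IsProbabilityMeasure μ] :
    RISGW μ μ = 0 :=
  le_antisymm ((RISGW_le one_mem_stiefel μ μ).trans_eq (SGW_self μ)) bot_le

lemma RISGW_comm (μ ν : Measure (EuclideanSpace ℝ (Fin p))) [IsProbabilityMeasure μ]
    [IsProbabilityMeasure ν] : RISGW μ ν = RISGW ν μ :=
  le_antisymm
    (le_iInf₂ fun _ hΔ =>
      (RISGW_le (transpose_mem_stiefel hΔ) μ ν).trans_eq (SGWmap_comm hΔ ν μ).symm)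
    (le_iInf₂ fun _ hΔ =>
      (RISGW_le (transpose_mem_stiefel hΔ) ν μ).trans_eq (SGWmap_comm hΔ μ ν).symm)

lemma RISGW_rpow_eq_iInf (μ ν : Measure (EuclideanSpace ℝ (Fin p))) :
    RISGW μ ν ^ (1 / 2 : ℝ) = ⨅ Δ ∈ stiefel p p, SGWmap Δ μ ν ^ (1 / 2 : ℝ) := by
  have h : ∀ x : ℝ≥0∞, x ^ (1 / 2 : ℝ) = ENNReal.orderIsoRpow (1 / 2) (by norm_num) x :=
    fun _ => rfl
  simp only [RISGW, h, OrderIso.map_iInf]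

lemma RISGW_triangle (μ ν ρ : Measure (EuclideanSpace ℝ (Fin p)))
    [IsProbabilityMeasure μ] [IsProbabilityMeasure ν] [IsProbabilityMeasure ρ] :
    RISGW μ ρ ^ (1 / 2 : ℝ) ≤ RISGW μ ν ^ (1 / 2 : ℝ) + RISGW ν ρ ^ (1 / 2 : ℝ) := by
  rw [RISGW_rpow_eq_iInf μ ν, RISGW_rpow_eq_iInf ν ρ]
  simp only [ENNReal.iInf_add, ENNReal.add_iInf]
  exact le_iInf₂ fun B hB => le_iInf₂ fun A hA =>
    (ENNReal.rpow_le_rpow (RISGW_le (mul_mem_stiefel hB hA) μ ρ) (by norm_num)).trans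
      (SGWmap_triangle A hB μ ν ρ)

lemma RISGW_map_left {Q : Matrix (Fin p) (Fin p) ℝ} (hQ : Q ∈ stiefel p p)
    (μ ν : Measure (EuclideanSpace ℝ (Fin p))) :
    RISGW (μ.map (Matrix.toEuclideanLin Q)) ν = RISGW μ ν := by
  have hQ' : Q.transpose * Q = 1 := hQ
  refine le_antisymm (le_iInf₂ fun Δ hΔ => ?_) (le_iInf₂ fun Δ hΔ => ?_)
  · refine (RISGW_le (mul_mem_stiefel hΔ (transpose_mem_stiefel hQ)) _ _).trans_eq ?_
    rw [SGWmap_map_left, Matrix.mul_assoc, hQ', mul_one]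
  · rw [SGWmap_map_left]
    exact RISGW_le (mul_mem_stiefel hΔ hQ) _ _

lemma RISGW_map_right {Q : Matrix (Fin p) (Fin p) ℝ} (hQ : Q ∈ stiefel p p)
    (μ ν : Measure (EuclideanSpace ℝ (Fin p))) :
    RISGW μ (ν.map (Matrix.toEuclideanLin Q)) = RISGW μ ν := by
  have hQ' : Q.transpose * Q = 1 := hQ
  refine le_antisymm (le_iInf₂ fun Δ hΔ => ?_) (le_iInf₂ fun Δ hΔ => ?_)
  · refine (RISGW_le (mul_mem_stiefel hQ hΔ) _ _).trans_eq ?_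
    rw [SGWmap_map_right _ hQ, ← Matrix.mul_assoc, hQ', one_mul]
  · rw [SGWmap_map_right _ hQ]
    exact RISGW_le (mul_mem_stiefel (transpose_mem_stiefel hQ) hΔ) _ _

end Orthogonal

/-! ### Vanishing Gromov-Wasserstein distance on the line -/

lemma forall_mem_support_sqDist_eq {π : Measure (ℝ × ℝ)} [SFinite π]
    (h : distortion sqDist sqDist π = 0) :
    ∀ z ∈ π.support, ∀ w ∈ π.support, sqDist z.1 w.1 = sqDist z.2 w.2 := by
  rw [distortion_eq_lintegral_prod measurable_sqDist measurable_sqDist, lintegral_eq_zero_iff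
    (measurable_distortion_integrand measurable_sqDist measurable_sqDist)] at h
  have h' : ∀ᵐ z ∂π, ∀ᵐ w ∂π, sqDist z.1 w.1 = sqDist z.2 w.2 := by
    refine Measure.ae_ae_of_ae_prod (p := fun u : (ℝ × ℝ) × ℝ × ℝ =>
      sqDist u.1.1 u.2.1 = sqDist u.1.2 u.2.2) (h.mono fun u hu => ?_)
    have h0 := ENNReal.ofReal_eq_zero.1 hu
    exact sub_eq_zero.1 (abs_eq_zero.1 (pow_eq_zero_iff two_ne_zero |>.1
      (le_antisymm h0 (sq_nonneg _))))
  have hcl : ∀ z : ℝ × ℝ, IsClosed {w : ℝ × ℝ | sqDist z.1 w.1 = sqDist z.2 w.2} := fun z => by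
    unfold sqDist; exact isClosed_eq (by fun_prop) (by fun_prop)
  have hcl' : IsClosed {z : ℝ × ℝ | ∀ w ∈ π.support, sqDist z.1 w.1 = sqDist z.2 w.2} := by
    simp only [Set.ofPred_forall]
    refine isClosed_iInter fun w => isClosed_iInter fun _ => ?_
    unfold sqDist; exact isClosed_eq (by fun_prop) (by fun_prop)
  exact Measure.support_subset_of_isClosed hcl' (h'.mono fun z hz =>
    Measure.support_subset_of_isClosed (hcl z) hz)

/-- A subset of the plane that is the graph of a distance-preserving relation lies on a line of
slope `±1`. -/
lemma exists_sign_of_sqDist_eq {S : Set (ℝ × ℝ)} (hS : S.Nonempty)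
    (h : ∀ z ∈ S, ∀ w ∈ S, sqDist z.1 w.1 = sqDist z.2 w.2) :
    ∃ s c : ℝ, (s = 1 ∨ s = -1) ∧ ∀ z ∈ S, z.2 = s * z.1 + c := by
  simp only [sqDist, sq_abs] at h
  obtain ⟨z₀, h₀⟩ := hS
  by_cases hne : ∃ z₁ ∈ S, z₁.1 ≠ z₀.1
  · obtain ⟨z₁, h₁, hne⟩ := hne
    obtain ⟨s, hs, hD⟩ : ∃ s : ℝ, (s = 1 ∨ s = -1) ∧ z₁.2 - z₀.2 = s * (z₁.1 - z₀.1) := by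
      rcases sq_eq_sq_iff_eq_or_eq_neg.1 (h z₁ h₁ z₀ h₀) with h' | h'
      · exact ⟨1, Or.inl rfl, by linarith⟩
      · exact ⟨-1, Or.inr rfl, by linarith⟩
    have hs2 : s * s = 1 := by rcases hs with rfl | rfl <;> norm_num
    refine ⟨s, z₀.2 - s * z₀.1, hs, fun z hz => ?_⟩
    have e₀ := h z hz z₀ h₀
    have e₁ := h z hz z₁ h₁
    -- subtracting the two equations leaves a linear equation with leading factor `z₁.1 - z₀.1`
    have hmul : (z₁.1 - z₀.1) * (s * (z.2 - z₀.2)) = (z₁.1 - z₀.1) * (z.1 - z₀.1) := by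
      have hz₁ : z₁.2 = z₀.2 + s * (z₁.1 - z₀.1) := by linarith
      rw [hz₁] at e₁
      linear_combination (e₁ - e₀) / 2 + (z₁.1 - z₀.1) ^ 2 / 2 * hs2
    have := mul_left_cancel₀ (sub_ne_zero.2 hne) hmul
    linear_combination s * this - (z.2 - z₀.2) * hs2
  · push Not at hne
    refine ⟨1, z₀.2 - z₀.1, Or.inl rfl, fun z hz => ?_⟩
    have e := h z hz z₀ h₀
    rw [hne z hz, sub_self, eq_comm, zero_pow two_ne_zero, sq_eq_zero_iff] at e
    rw [hne z hz]; linarith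

lemma exists_map_of_GWsq_eq_zero {α β : Measure ℝ} [IsProbabilityMeasure α]
    [IsProbabilityMeasure β] (h : GWsq sqDist sqDist α β = 0) :
    ∃ s c : ℝ, (s = 1 ∨ s = -1) ∧ β = α.map fun t => s * t + c := by
  obtain ⟨π, hπ, hdist⟩ := exists_isCoupling_distortion_eq α β
  have := hπ.isProbabilityMeasure
  obtain ⟨s, c, hs, hline⟩ := exists_sign_of_sqDist_eq
    (Measure.nonempty_support (IsProbabilityMeasure.ne_zero π))
    (forall_mem_support_sqDist_eq (hdist.trans h))
  refine ⟨s, c, hs, ?_⟩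
  rw [← hπ.1, ← hπ.2, Measure.map_map (by fun_prop) measurable_fst]
  exact Measure.map_congr (Filter.mem_of_superset Measure.support_mem_ae hline)

/-! ### Characteristic functions of compactly supported measures -/

section CharFun

variable {E : Type*} [NormedAddCommGroup E] [InnerProductSpace ℝ E] [MeasurableSpace E]

/-- The restriction of the characteristic function of `μ` to the line `t ↦ a + t v`, extended to
complex `t`. -/
noncomputable def lineCharFun (μ : Measure E) (a v : E) (z : ℂ) : ℂ :=
  ∫ x, Complex.exp (((inner ℝ x a : ℝ) + z * (inner ℝ x v : ℝ)) * Complex.I) ∂μ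

lemma lineCharFun_ofReal (μ : Measure E) (a v : E) (t : ℝ) :
    lineCharFun μ a v t = charFun μ (a + t • v) := by
  simp [lineCharFun, charFun_apply, inner_add_right, inner_smul_right]

lemma differentiable_lineCharFun [BorelSpace E] {μ : Measure E} [IsFiniteMeasure μ] {R : ℝ}
    (hR : ∀ᵐ x ∂μ, ‖x‖ ≤ R) (a v : E) : Differentiable ℂ (lineCharFun μ a v) := by
  intro z₀
  have hnorm : ∀ z ∈ Metric.ball z₀ 1, ∀ x : E, ‖x‖ ≤ R →
      ‖Complex.exp (((inner ℝ x a : ℝ) + z * (inner ℝ x v : ℝ)) * Complex.I)‖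
        ≤ Real.exp ((‖z₀‖ + 1) * (R * ‖v‖)) := by
    intro z hz x hx
    rw [Complex.norm_exp]
    refine Real.exp_le_exp.2 ?_
    have h1 : |z.im| ≤ ‖z₀‖ + 1 := by
      have h2 : ‖z‖ ≤ ‖z₀‖ + ‖z - z₀‖ := norm_le_norm_add_norm_sub' z z₀
      have h3 := mem_ball_iff_norm.1 hz
      linarith [Complex.abs_im_le_norm z]
    have h4 : |(inner ℝ x v : ℝ)| ≤ R * ‖v‖ :=
      (abs_real_inner_le_norm x v).trans (by gcongr)
    have h5 : ((((inner ℝ x a : ℝ) + z * (inner ℝ x v : ℝ)) * Complex.I : ℂ)).re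
        = -(z.im * inner ℝ x v) := by simp
    rw [h5]
    refine (neg_le_abs _).trans ?_
    rw [abs_mul]
    exact mul_le_mul h1 h4 (abs_nonneg _) (by positivity)
  have hmeas : ∀ z : ℂ, AEStronglyMeasurable (fun x : E =>
      Complex.exp (((inner ℝ x a : ℝ) + z * (inner ℝ x v : ℝ)) * Complex.I)) μ := fun z =>
    (Continuous.aestronglyMeasurable (by fun_prop))
  refine (hasDerivAt_integral_of_dominated_loc_of_deriv_le
    (F' := fun z x => Complex.exp (((inner ℝ x a : ℝ) + z * (inner ℝ x v : ℝ)) * Complex.I)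
      * ((inner ℝ x v : ℝ) * Complex.I))
    (bound := fun _ => Real.exp ((‖z₀‖ + 1) * (R * ‖v‖)) * (R * ‖v‖))
    (Metric.ball_mem_nhds z₀ one_pos) (.of_forall hmeas) ?_ ?_ ?_ (integrable_const _) ?_
    ).2.differentiableAt
  · exact Integrable.of_bound (hmeas z₀) _
      (hR.mono fun x hx => hnorm z₀ (Metric.mem_ball_self one_pos) x hx)
  · exact (Continuous.aestronglyMeasurable (by fun_prop))
  · filter_upwards [hR] with x hx z hz
    rw [norm_mul, norm_mul, Complex.norm_I, mul_one, Complex.norm_real, Real.norm_eq_abs]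
    refine mul_le_mul (hnorm z hz x hx) ?_ (abs_nonneg _) (Real.exp_nonneg _)
    exact (abs_real_inner_le_norm x v).trans (by gcongr)
  · refine .of_forall fun x z _ => ?_
    have h1 : HasDerivAt (fun z : ℂ =>
        ((inner ℝ x a : ℝ) + z * (inner ℝ x v : ℝ)) * Complex.I)
        ((inner ℝ x v : ℝ) * Complex.I) z := by
      simpa using (((hasDerivAt_id z).mul_const ((inner ℝ x v : ℝ) : ℂ)).const_add
        ((inner ℝ x a : ℝ) : ℂ)).mul_const Complex.I
    exact h1.cexp

lemma analyticOnNhd_charFun_line [BorelSpace E] {μ : Measure E} [IsFiniteMeasure μ] {R : ℝ}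
    (hR : ∀ᵐ x ∂μ, ‖x‖ ≤ R) (a v : E) :
    AnalyticOnNhd ℝ (fun t : ℝ => charFun μ (a + t • v)) Set.univ := by
  intro t _
  have h := ((differentiable_lineCharFun hR a v).analyticAt (t : ℂ)).restrictScalars (𝕜 := ℝ)
  have h' := h.comp (Complex.ofRealCLM.analyticAt t)
  convert h' using 1
  funext t
  exact (lineCharFun_ofReal μ a v t).symm

/-- Measures `μ`, `ν` with bounded support whose characteristic functions satisfy
`φ_ν(ξ) ∈ {φ_μ(ξ), φ_μ(-ξ)}` pointwise: the same alternative holds at all `ξ`, because the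
product of two real-analytic functions on a line vanishes only if one of them does. -/
lemma eq_or_eq_map_neg_of_charFun [BorelSpace E] [SecondCountableTopology E] [CompleteSpace E]
    {μ ν : Measure E} [IsFiniteMeasure μ] [IsFiniteMeasure ν] {R R' : ℝ}
    (hμ : ∀ᵐ x ∂μ, ‖x‖ ≤ R) (hν : ∀ᵐ x ∂ν, ‖x‖ ≤ R')
    (h : ∀ ξ, (charFun ν ξ - charFun μ ξ) * (charFun ν ξ - charFun μ (-ξ)) = 0) :
    ν = μ ∨ ν = μ.map fun x => -x := by
  have hneg : ∀ ξ, charFun (μ.map fun x => -x) ξ = charFun μ (-ξ) := fun ξ => by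
    simpa using charFun_map_smul (μ := μ) (-1) ξ
  have : IsFiniteMeasure (μ.map fun x => -x) := Measure.isFiniteMeasure_map μ _
  by_contra! hcon
  obtain ⟨a, ha⟩ : ∃ a, charFun ν a ≠ charFun μ a := by
    by_contra! hall
    exact hcon.1 (Measure.ext_of_charFun (funext hall))
  obtain ⟨b, hb⟩ : ∃ b, charFun ν b ≠ charFun μ (-b) := by
    by_contra! hall
    exact hcon.2 (Measure.ext_of_charFun (funext fun ξ => (hall ξ).trans (hneg ξ).symm))
  have hf := (analyticOnNhd_charFun_line hν a (b - a)).sub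
    (analyticOnNhd_charFun_line hμ a (b - a))
  have hg := (analyticOnNhd_charFun_line hν a (b - a)).sub
    (analyticOnNhd_charFun_line hμ (-a) (-(b - a)))
  rcases hf.eq_zero_or_eq_zero_of_mul_eq_zero hg (fun t _ => by
    simp only [Pi.sub_apply, smul_neg, ← neg_add]; exact h _) isPreconnected_univ with h0 | h0
  · have := h0 0 trivial
    simp only [Pi.sub_apply, zero_smul, add_zero] at this
    exact ha (sub_eq_zero.1 this)
  · have := h0 1 trivial
    simp only [Pi.sub_apply, one_smul, ← neg_add, add_sub_cancel] at this
    exact hb (sub_eq_zero.1 this)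

end CharFun

/-! ### Vanishing sliced discrepancy -/

section Vanishing

variable {p : ℕ}

lemma charFun_smul_eq_charFun_map_proj (μ : Measure (EuclideanSpace ℝ (Fin p)))
    (θ : EuclideanSpace ℝ (Fin p)) (r : ℝ) :
    charFun μ (r • θ) = charFun (μ.map (proj θ)) r := by
  rw [charFun_apply, charFun_apply_real, integral_map (continuous_proj θ).aemeasurable
    (Continuous.aestronglyMeasurable (by fun_prop))]
  simp [proj, inner_smul_right]

lemma ae_GWsq_eq_zero_of_SGW_eq_zero {μ ν : Measure (EuclideanSpace ℝ (Fin p))}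
    [IsProbabilityMeasure μ] [IsProbabilityMeasure ν] (h : SGW μ ν = 0) :
    ∀ᵐ θ : Metric.sphere (0 : EuclideanSpace ℝ (Fin p)) 1
      ∂(volume : Measure (EuclideanSpace ℝ (Fin p))).toSphere,
      GWsq sqDist sqDist (μ.map (proj θ.1)) (ν.map (proj θ.1)) = 0 := by
  rw [SGW, SGWmap_eq, laverage] at h
  simp only [Matrix.transpose_one, toEuclideanLin_one_apply] at h
  rw [lintegral_eq_zero_iff (measurable_GWsq_map_proj μ ν continuous_subtype_val
    continuous_subtype_val)] at h
  exact (Measure.ae_ennreal_smul_measure_iff (ENNReal.inv_ne_zero.2 (measure_ne_top _ _))).1 h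

lemma integral_proj (μ : Measure (EuclideanSpace ℝ (Fin p))) (θ : EuclideanSpace ℝ (Fin p)) :
    ∫ t, t ∂(μ.map (proj θ)) = ∫ x, proj θ x ∂μ :=
  integral_map (continuous_proj θ).aemeasurable aestronglyMeasurable_id

/-- Centred measures of bounded support at sliced discrepancy zero agree up to the sign `x ↦ -x`.
In almost every direction the projections agree up to sign, the translation being excluded by
centring. -/
lemma eq_or_eq_map_neg_of_SGW_eq_zero {μ ν : Measure (EuclideanSpace ℝ (Fin p))}
    [IsProbabilityMeasure μ] [IsProbabilityMeasure ν] {R R' : ℝ} (hμ : ∀ᵐ x ∂μ, ‖x‖ ≤ R)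
    (hν : ∀ᵐ x ∂ν, ‖x‖ ≤ R') (hμ0 : ∫ x, x ∂μ = 0) (hν0 : ∫ x, x ∂ν = 0) (h : SGW μ ν = 0) :
    ν = μ ∨ ν = μ.map fun x => -x := by
  refine eq_or_eq_map_neg_of_charFun hμ hν ?_
  have hint : ∀ (μ : Measure (EuclideanSpace ℝ (Fin p))) [IsProbabilityMeasure μ] (R : ℝ),
      (∀ᵐ x ∂μ, ‖x‖ ≤ R) → ∫ x, x ∂μ = 0 → ∀ θ, Integrable (fun t : ℝ => t) (μ.map (proj θ)) ∧
        ∫ t, t ∂(μ.map (proj θ)) = 0 := by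
    intro μ _ R hR h0 θ
    have hi : Integrable (fun x => x) μ := Integrable.of_bound aestronglyMeasurable_id R hR
    refine ⟨?_, ?_⟩
    · exact (integrable_map_measure aestronglyMeasurable_id
        (continuous_proj θ).aemeasurable).2 (hi.inner_const θ)
    · rw [integral_proj]
      simp only [proj, real_inner_comm]
      rw [integral_inner hi, h0, inner_zero_right]
  have hae : ∀ᵐ θ : Metric.sphere (0 : EuclideanSpace ℝ (Fin p)) 1
      ∂(volume : Measure (EuclideanSpace ℝ (Fin p))).toSphere, ∀ r : ℝ,
      (charFun ν (r • θ.1) - charFun μ (r • θ.1))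
        * (charFun ν (r • θ.1) - charFun μ (-(r • θ.1))) = 0 := by
    filter_upwards [ae_GWsq_eq_zero_of_SGW_eq_zero h] with θ hθ r
    have := isProbabilityMeasure_map_proj μ θ.1
    have := isProbabilityMeasure_map_proj ν θ.1
    obtain ⟨s, c, hs, hmap⟩ := exists_map_of_GWsq_eq_zero hθ
    obtain ⟨hi, hm⟩ := hint μ R hμ hμ0 θ.1
    have hc : c = 0 := by
      have h1 := (hint ν R' hν hν0 θ.1).2
      rw [hmap, integral_map (f := fun t : ℝ => t) (by fun_prop) aestronglyMeasurable_id,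
        integral_add (hi.const_mul s) (integrable_const c), integral_const_mul, hm] at h1
      simpa using h1
    have hchar : charFun ν (r • θ.1) = charFun μ ((s * r) • θ.1) := by
      rw [charFun_smul_eq_charFun_map_proj, charFun_smul_eq_charFun_map_proj, hmap, hc]
      simp only [add_zero]
      exact charFun_map_mul s r
    rcases hs with rfl | rfl
    · rw [hchar, one_mul, sub_self, zero_mul]
    · rw [hchar, neg_one_mul, neg_smul, sub_self, mul_zero]
  have hcont : Continuous fun ξ => (charFun ν ξ - charFun μ ξ)
      * (charFun ν ξ - charFun μ (-ξ)) :=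
    (continuous_charFun.sub continuous_charFun).mul
      (continuous_charFun.sub (continuous_charFun.comp continuous_neg))
  intro ξ
  rcases eq_or_ne ξ 0 with rfl | hξ
  · simp
  have hdense := Measure.dense_of_ae hae
  have hall : ∀ θ : Metric.sphere (0 : EuclideanSpace ℝ (Fin p)) 1,
      (charFun ν (‖ξ‖ • θ.1) - charFun μ (‖ξ‖ • θ.1))
        * (charFun ν (‖ξ‖ • θ.1) - charFun μ (-(‖ξ‖ • θ.1))) = 0 := by
    have hcl : IsClosed {θ : Metric.sphere (0 : EuclideanSpace ℝ (Fin p)) 1 |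
        (charFun ν (‖ξ‖ • θ.1) - charFun μ (‖ξ‖ • θ.1))
          * (charFun ν (‖ξ‖ • θ.1) - charFun μ (-(‖ξ‖ • θ.1))) = 0} :=
      isClosed_eq (hcont.comp (continuous_subtype_val.const_smul ‖ξ‖)) continuous_const
    intro θ
    exact closure_minimal (fun θ hθ => Set.mem_ofPred_eq ▸ hθ ‖ξ‖) hcl (hdense θ)
  have h1 := hall ⟨‖ξ‖⁻¹ • ξ, by simp [norm_smul, hξ]⟩
  simpa [smul_smul, hξ] using h1

lemma exists_norm_le_of_isCompact_support {μ : Measure (EuclideanSpace ℝ (Fin p))}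
    (h : IsCompact μ.support) : ∃ R : ℝ, ∀ᵐ x ∂μ, ‖x‖ ≤ R := by
  obtain ⟨R, hR⟩ := h.isBounded.exists_norm_le
  exact ⟨R, Filter.mem_of_superset Measure.support_mem_ae hR⟩

/-- Without centring, the two measures agree up to a translation or a point reflection. -/
lemma exists_eq_map_of_SGW_eq_zero {μ ν : Measure (EuclideanSpace ℝ (Fin p))}
    [IsProbabilityMeasure μ] [IsProbabilityMeasure ν] (hμ : IsCompact μ.support)
    (hν : IsCompact ν.support) (h : SGW μ ν = 0) :
    ∃ c, ν = μ.map (fun x => x + c) ∨ ν = μ.map fun x => -x + c := by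
  obtain ⟨R, hR⟩ := exists_norm_le_of_isCompact_support hμ
  obtain ⟨R', hR'⟩ := exists_norm_le_of_isCompact_support hν
  have hshift : ∀ (μ : Measure (EuclideanSpace ℝ (Fin p))) [IsProbabilityMeasure μ] (R : ℝ),
      (∀ᵐ x ∂μ, ‖x‖ ≤ R) → ∃ m, IsProbabilityMeasure (μ.map fun x => x + -m) ∧
        (∃ R', ∀ᵐ x ∂(μ.map fun x => x + -m), ‖x‖ ≤ R') ∧
        ∫ x, x ∂(μ.map fun x => x + -m) = 0 := by
    intro μ _ R hR
    have hi : Integrable (fun x => x) μ := Integrable.of_bound aestronglyMeasurable_id R hR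
    refine ⟨∫ x, x ∂μ, Measure.isProbabilityMeasure_map (by fun_prop),
      ⟨R + ‖-∫ x, x ∂μ‖, ?_⟩, ?_⟩
    · rw [ae_map_iff (by fun_prop) (measurableSet_le (by fun_prop) (by fun_prop))]
      exact hR.mono fun x hx => (norm_add_le _ _).trans (by gcongr)
    · rw [integral_map (f := fun x => x) (by fun_prop) aestronglyMeasurable_id,
        integral_add hi (integrable_const _)]
      simp
  obtain ⟨m, hm, ⟨R₁, hR₁⟩, hm0⟩ := hshift μ R hR
  obtain ⟨n, hn, ⟨R₂, hR₂⟩, hn0⟩ := hshift ν R' hR'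
  have hback : ν = (ν.map fun x => x + -n).map fun x => x + n := by
    rw [Measure.map_map (by fun_prop) (by fun_prop)]
    simp [Function.comp_def]
  rcases eq_or_eq_map_neg_of_SGW_eq_zero hR₁ hR₂ hm0 hn0
    ((SGWmap_translate 1 μ ν (-m) (-n)).trans h) with h' | h'
  · refine ⟨-m + n, Or.inl ?_⟩
    rw [hback, h', Measure.map_map (by fun_prop) (by fun_prop)]
    simp only [Function.comp_def, add_assoc]
  · refine ⟨m + n, Or.inr ?_⟩
    rw [hback, h', Measure.map_map (by fun_prop) (by fun_prop),
      Measure.map_map (by fun_prop) (by fun_prop)]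
    simp only [Function.comp_def, neg_add, neg_neg, add_assoc]

lemma mem_support_map_iff {X : Type*} [TopologicalSpace X] [MeasurableSpace X] [BorelSpace X]
    (μ : Measure X) (e : X ≃ₜ X) (x : X) : e x ∈ (μ.map e).support ↔ x ∈ μ.support := by
  simp only [Measure.mem_support_iff_forall]
  have hmap : ∀ U, μ.map e U = μ (e ⁻¹' U) := fun U => e.toMeasurableEquiv.map_apply U
  simp only [hmap]
  constructor
  · intro h U hU
    simpa using h (e '' U) (e.isOpenMap.image_mem_nhds hU)
  · exact fun h U hU => h _ (e.continuous.continuousAt hU)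

lemma isomorphic_map {X : Type*} [TopologicalSpace X] [MeasurableSpace X] [BorelSpace X]
    {c : X → X → ℝ} (μ : Measure X) (e : X ≃ₜ X) (he : ∀ x x', c (e x) (e x') = c x x') :
    Isomorphic c c μ (μ.map e) := by
  refine ⟨e, fun x hx => (mem_support_map_iff μ e x).2 hx, fun y hy => ?_,
    e.measurable.aemeasurable, rfl, fun x _ x' _ => he x x'⟩
  refine ⟨e.symm y, ?_, e.apply_symm_apply y⟩
  rw [← mem_support_map_iff μ e, e.apply_symm_apply]
  exact hy

lemma measurable_l1Dist : Measurable (Function.uncurry (l1Dist (p := p))) := by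
  unfold l1Dist Function.uncurry
  exact Continuous.measurable (by fun_prop)

lemma isomorphic_and_GW_eq_zero_of_SGW_eq_zero {μ ν : Measure (EuclideanSpace ℝ (Fin p))}
    [IsProbabilityMeasure μ] [IsProbabilityMeasure ν] (hμ : IsCompact μ.support)
    (hν : IsCompact ν.support) (h : SGW μ ν = 0) :
    Isomorphic l1Dist l1Dist μ ν ∧ GW l1Dist l1Dist μ ν = 0 := by
  obtain ⟨e, he, rfl⟩ : ∃ e : EuclideanSpace ℝ (Fin p) ≃ₜ EuclideanSpace ℝ (Fin p),
      (∀ x x', l1Dist (e x) (e x') = l1Dist x x') ∧ ν = μ.map e := by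
    obtain ⟨c, hc | hc⟩ := exists_eq_map_of_SGW_eq_zero hμ hν h
    · exact ⟨Homeomorph.addRight c, fun x x' => by simp [l1Dist], hc⟩
    · refine ⟨(Homeomorph.neg _).trans (Homeomorph.addRight c), fun x x' => ?_, hc⟩
      simp only [l1Dist]
      refine Finset.sum_congr rfl fun i _ => ?_
      rw [← abs_neg]
      simp [neg_add_eq_sub]
  refine ⟨isomorphic_map μ e he, ?_⟩
  rw [GW, GWsq_map_eq_zero μ e.measurable he measurable_l1Dist measurable_l1Dist]
  norm_num

end Vanishing

end SlicedGW

theorem theorem3 :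
    -- translation invariance of `SGW_Δ`, for every `Δ`
    (∀ (p q : ℕ) (Δ : Matrix (Fin q) (Fin p) ℝ)
      (μ : Measure (EuclideanSpace ℝ (Fin p))) (ν : Measure (EuclideanSpace ℝ (Fin q)))
      [IsProbabilityMeasure μ] [IsProbabilityMeasure ν]
      (a : EuclideanSpace ℝ (Fin p)) (b : EuclideanSpace ℝ (Fin q)),
      SlicedGW.SGWmap Δ (μ.map fun x => x + a) (ν.map fun y => y + b)
        = SlicedGW.SGWmap Δ μ ν) ∧
    -- translation invariance of `RISGW`
    (∀ (p q : ℕ), p ≤ q →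
      ∀ (μ : Measure (EuclideanSpace ℝ (Fin p))) (ν : Measure (EuclideanSpace ℝ (Fin q)))
      [IsProbabilityMeasure μ] [IsProbabilityMeasure ν]
      (a : EuclideanSpace ℝ (Fin p)) (b : EuclideanSpace ℝ (Fin q)),
      SlicedGW.RISGW (μ.map fun x => x + a) (ν.map fun y => y + b)
        = SlicedGW.RISGW μ ν) ∧
    -- orthogonal invariance of `RISGW` when `p = q`
    (∀ (p : ℕ) (Q : Matrix (Fin p) (Fin p) ℝ), Q ∈ Matrix.orthogonalGroup (Fin p) ℝ →
      ∀ (μ ν : Measure (EuclideanSpace ℝ (Fin p)))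
      [IsProbabilityMeasure μ] [IsProbabilityMeasure ν],
      SlicedGW.RISGW (μ.map (Matrix.toEuclideanLin Q)) ν = SlicedGW.RISGW μ ν ∧
      SlicedGW.RISGW μ (ν.map (Matrix.toEuclideanLin Q)) = SlicedGW.RISGW μ ν) ∧
    -- pseudo-distance properties of `SGW`
    (∀ (p : ℕ) (μ ν ρ : Measure (EuclideanSpace ℝ (Fin p)))
      [IsProbabilityMeasure μ] [IsProbabilityMeasure ν] [IsProbabilityMeasure ρ],
      SlicedGW.SGW μ ν = SlicedGW.SGW ν μ ∧
      SlicedGW.SGW μ ρ ^ (1 / 2 : ℝ)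
        ≤ SlicedGW.SGW μ ν ^ (1 / 2 : ℝ) + SlicedGW.SGW ν ρ ^ (1 / 2 : ℝ) ∧
      SlicedGW.SGW μ μ = 0) ∧
    -- pseudo-distance properties of `RISGW`
    (∀ (p : ℕ) (μ ν ρ : Measure (EuclideanSpace ℝ (Fin p)))
      [IsProbabilityMeasure μ] [IsProbabilityMeasure ν] [IsProbabilityMeasure ρ],
      SlicedGW.RISGW μ ν = SlicedGW.RISGW ν μ ∧
      SlicedGW.RISGW μ ρ ^ (1 / 2 : ℝ)
        ≤ SlicedGW.RISGW μ ν ^ (1 / 2 : ℝ) + SlicedGW.RISGW ν ρ ^ (1 / 2 : ℝ) ∧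
      SlicedGW.RISGW μ μ = 0) ∧
    -- what `SGW(μ, ν) = 0` implies for compactly supported measures
    (∀ (p : ℕ) (μ ν : Measure (EuclideanSpace ℝ (Fin p)))
      [IsProbabilityMeasure μ] [IsProbabilityMeasure ν],
      IsCompact μ.support → IsCompact ν.support → SlicedGW.SGW μ ν = 0 →
      SlicedGW.Isomorphic SlicedGW.l1Dist SlicedGW.l1Dist μ ν ∧
      SlicedGW.GW SlicedGW.l1Dist SlicedGW.l1Dist μ ν = 0) := by
  refine ⟨?_, ?_, ?_, ?_, ?_, ?_⟩
  · intro p q Δ μ ν _ _ a b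
    exact SlicedGW.SGWmap_translate Δ μ ν a b
  · intro p q _ μ ν _ _ a b
    exact SlicedGW.RISGW_translate μ ν a b
  · intro p Q hQ μ ν _ _
    have hQ' := SlicedGW.mem_stiefel_of_mem_orthogonalGroup hQ
    exact ⟨SlicedGW.RISGW_map_left hQ' μ ν, SlicedGW.RISGW_map_right hQ' μ ν⟩
  · intro p μ ν ρ _ _ _
    exact ⟨SlicedGW.SGW_comm μ ν, SlicedGW.SGW_triangle μ ν ρ, SlicedGW.SGW_self μ⟩
  · intro p μ ν ρ _ _ _
    exact ⟨SlicedGW.RISGW_comm μ ν, SlicedGW.RISGW_triangle μ ν ρ, SlicedGW.RISGW_self μ⟩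
  · intro p μ ν _ _ hμ hν h
    exact SlicedGW.isomorphic_and_GW_eq_zero_of_SGW_eq_zero hμ hν h
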